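/- Let $X$ be an arbitrary topological space. Write $I=[0,1]$, let $X_+=X\sqcup\{*\}$ be $X$ with an added isolated basepoint, and let $$\Sigma(X_+)=(X_+\times I)\big/\big(X_+\times\{0,1\}\cup\{*\}\times I\big)$$ be its reduced suspension, with the quotient topology and with the image of the collapsed set as basepoint. For a space $Y$ with basepoint $y_0$: - $\pi_0^{qtop}(Y)$ is the set of path components of $Y$ with the quotient topology from $Y$; - $\pi_1^{qtop}(Y)$ is the fundamental group $\pi_1(Y,y_0)$ with the quotient topology from the loop space $\Omega(Y,y_0)$, which carries the compact-open topology; - $\pi_1^{\tau}(Y)$ is the group $\pi_1(Y,y_0)$ with the quotient topology with respect to the homomorphism $F_M(\pi_1^{qtop}(Y))\to\pi_1(Y,y_0)$ induced by the identity map, where $F_M(Z)$ denotes the free (Markov) topological group on a space $Z$, that is, the free group on the set $Z$ with the finest group topology making the canonical map $Z\to F_M(Z)$ continuous. A space is called functionally Hausdorff if any two distinct points are separated by a continuous real-valued function. Then the following are equivalent: 1. $\pi_1^{\tau}(\Sigma(X_+))$ is Hausdorff; 2. $\pi_1^{qtop}(\Sigma(X_+))$ is functionally Hausdorff; 3. $\pi_0^{qtop}(X)$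 is functionally Hausdorff. -/

import Mathlib

open scoped unitInterval

universe u v

/-- A space is functionally Hausdorff if distinct points can be separated by a continuous
real-valued function. -/
def FunctionallyHausdorff (Y : Type u) [TopologicalSpace Y] : Prop :=
  ∀ x y : Y, x ≠ y → ∃ f : C(Y, ℝ), f x ≠ f y

section ReducedSuspension

variable (Y : Type u) [TopologicalSpace Y] (y₀ : Y)

/-- The subset `Y × {0, 1} ∪ {y₀} × I` of `Y × I`. -/
def suspensionCollapsed : Set (Y × I) :=
  {p | p.2 = 0 ∨ p.2 = 1 ∨ p.1 = y₀}

/-- The equivalence relation on `Y × I` collapsing `Y × {0, 1} ∪ {y₀} × I` to a point. -/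
def suspensionSetoid : Setoid (Y × I) where
  r p q := p = q ∨ (p ∈ suspensionCollapsed Y y₀ ∧ q ∈ suspensionCollapsed Y y₀)
  iseqv :=
    { refl := fun _ => Or.inl rfl
      symm := by
        rintro p q (h | ⟨h₁, h₂⟩)
        · exact Or.inl h.symm
        · exact Or.inr ⟨h₂, h₁⟩
      trans := by
        rintro p q r (rfl | ⟨h₁, h₂⟩) (rfl | ⟨h₃, h₄⟩)
        · exact Or.inl rfl
        · exact Or.inr ⟨h₃, h₄⟩
        · exact Or.inr ⟨h₁, h₂⟩
        · exact Or.inr ⟨h₁, h₄⟩ }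

/-- The reduced suspension `Σ(Y, y₀) = (Y × I) / (Y × {0, 1} ∪ {y₀} × I)`. -/
def ReducedSuspension : Type u :=
  Quotient (suspensionSetoid Y y₀)

/-- The quotient topology of the product topology on `Y × I`. -/
instance : TopologicalSpace (ReducedSuspension Y y₀) :=
  inferInstanceAs (TopologicalSpace (Quotient (suspensionSetoid Y y₀)))

/-- The basepoint of the reduced suspension: the image of the collapsed set. -/
def ReducedSuspension.base : ReducedSuspension Y y₀ :=
  Quotient.mk (suspensionSetoid Y y₀) (y₀, 0)

end ReducedSuspension

/-- The generalized wedge of circles `Σ(X₊)`: the reduced suspension of the disjoint union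
`X₊ = X ⊔ {∗}`, whose basepoint `∗` is isolated. -/
abbrev GeneralizedWedge (X : Type u) [TopologicalSpace X] : Type u :=
  ReducedSuspension (X ⊕ PUnit.{u + 1}) (Sum.inr PUnit.unit)

/-- The canonical basepoint of `Σ(X₊)`. -/
abbrev GeneralizedWedge.base (X : Type u) [TopologicalSpace X] : GeneralizedWedge X :=
  ReducedSuspension.base (X ⊕ PUnit.{u + 1}) (Sum.inr PUnit.unit)

section Pi1Qtop

/-- The quasitopological fundamental group: the fundamental group, topologized as a quotient
of the loop space. -/
def Pi1Qtop (X : Type u) [TopologicalSpace X] (x₀ : X) : Type u :=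
  FundamentalGroup X x₀

noncomputable instance (X : Type u) [TopologicalSpace X] (x₀ : X) : Group (Pi1Qtop X x₀) :=
  inferInstanceAs (Group (FundamentalGroup X x₀))

/-- The map from the loop space `Ω(X, x₀)` (Mathlib's `Path x₀ x₀`, with the compact-open
topology) to the fundamental group, identifying homotopic loops. -/
def Pi1Qtop.mk (X : Type u) [TopologicalSpace X] (x₀ : X) (γ : Path x₀ x₀) : Pi1Qtop X x₀ :=
  FundamentalGroup.fromPath (Path.Homotopic.Quotient.mk γ)

/-- The quotient topology with respect to `Ω(X, x₀) → π₁(X, x₀)`. -/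
instance (X : Type u) [TopologicalSpace X] (x₀ : X) : TopologicalSpace (Pi1Qtop X x₀) :=
  TopologicalSpace.coinduced (Pi1Qtop.mk X x₀) inferInstance

end Pi1Qtop

section Tau

/-- The free (Markov) topological group on `Y`: the free group on the underlying set of `Y`. -/
def FreeTopGroup (Y : Type u) : Type u := FreeGroup Y

instance (Y : Type u) : Group (FreeTopGroup Y) := inferInstanceAs (Group (FreeGroup Y))

/-- The canonical map `σ : Y → F_M(Y)`. -/
def FreeTopGroup.of {Y : Type u} (y : Y) : FreeTopGroup Y := FreeGroup.of y

/-- The topology of `F_M(Y)`: the finest group topology for which `σ` is continuous. -/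
instance (Y : Type u) [TopologicalSpace Y] : TopologicalSpace (FreeTopGroup Y) :=
  (GroupTopology.coinduced (FreeTopGroup.of : Y → FreeTopGroup Y)).toTopologicalSpace

instance (Y : Type u) [TopologicalSpace Y] : IsTopologicalGroup (FreeTopGroup Y) :=
  (GroupTopology.coinduced (FreeTopGroup.of : Y → FreeTopGroup Y)).toIsTopologicalGroup

theorem FreeTopGroup.continuous_of (Y : Type u) [TopologicalSpace Y] :
    Continuous (FreeTopGroup.of : Y → FreeTopGroup Y) :=
  GroupTopology.coinduced_continuous _

/-- The homomorphism `F_M(Y) → H` extending a function `f : Y → H`. -/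
def FreeTopGroup.lift {Y : Type u} {H : Type v} [Group H] (f : Y → H) : FreeTopGroup Y →* H :=
  (FreeGroup.lift f : FreeGroup Y →* H)

/-- The universal property of the free topological group. -/
theorem FreeTopGroup.continuous_lift {Y : Type u} [TopologicalSpace Y] {H : Type v} [Group H]
    [TopologicalSpace H] [IsTopologicalGroup H] (f : Y → H) (hf : Continuous f) :
    Continuous (FreeTopGroup.lift f) := by
  let b : GroupTopology (FreeTopGroup Y) :=
    { toTopologicalSpace := TopologicalSpace.induced (FreeTopGroup.lift f) inferInstance
      toIsTopologicalGroup := topologicalGroup_induced (FreeTopGroup.lift f) }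
  rw [continuous_iff_le_induced]
  have hb : GroupTopology.coinduced (FreeTopGroup.of : Y → FreeTopGroup Y) ≤ b := by
    refine sInf_le ?_
    change TopologicalSpace.coinduced _ _ ≤ TopologicalSpace.induced _ _
    rw [← continuous_iff_coinduced_le, continuous_induced_rng]
    have : (FreeTopGroup.lift f : FreeTopGroup Y → H) ∘ FreeTopGroup.of = f := by
      funext y
      exact FreeGroup.lift_apply_of
    rw [this]
    exact hf
  exact hb

/-- For a group with topology `G` (no compatibility required), `τ(G)` has underlying group `G`. -/
def Tau (G : Type u) : Type u := G

instance (G : Type u) [Group G] : Group (Tau G) := inferInstanceAs (Group G)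

/-- The multiplication epimorphism `m_G : F_M(G) → G` induced by the identity of `G`. -/
def Tau.mulHom (G : Type u) [Group G] : FreeTopGroup G →* Tau G :=
  FreeTopGroup.lift (fun g : G => (g : Tau G))

/-- The topology of `τ(G)`: the quotient topology with respect to `m_G : F_M(G) → G`. -/
instance (G : Type u) [Group G] [TopologicalSpace G] : TopologicalSpace (Tau G) :=
  TopologicalSpace.coinduced (Tau.mulHom G) inferInstance

theorem Tau.mulHom_surjective (G : Type u) [Group G] : Function.Surjective (Tau.mulHom G) :=
  fun g => ⟨FreeTopGroup.of (Y := G) g, FreeGroup.lift_apply_of⟩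

instance (G : Type u) [Group G] [TopologicalSpace G] : IsTopologicalGroup (Tau G) := by
  have hq : Topology.IsQuotientMap (Tau.mulHom G) := ⟨⟨rfl⟩, Tau.mulHom_surjective G⟩
  have ho : IsOpenQuotientMap (Tau.mulHom G) := MonoidHom.isOpenQuotientMap_of_isQuotientMap hq
  refine { continuous_mul := ?_, continuous_inv := ?_ }
  · rw [(ho.prodMap ho).isQuotientMap.continuous_iff]
    have : (fun p : Tau G × Tau G => p.1 * p.2) ∘ Prod.map (Tau.mulHom G) (Tau.mulHom G) =
        fun p => Tau.mulHom G (p.1 * p.2) := by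
      funext p
      simp
    rw [this]
    exact hq.continuous.comp continuous_mul
  · rw [hq.continuous_iff]
    have : (fun p : Tau G => p⁻¹) ∘ (Tau.mulHom G) = fun p => Tau.mulHom G p⁻¹ := by
      funext p
      simp
    rw [this]
    exact hq.continuous.comp continuous_inv

/-- The topological group `π₁^τ(X, x₀) = τ(π₁^qtop(X, x₀))`. -/
abbrev Pi1Tau (X : Type u) [TopologicalSpace X] (x₀ : X) : Type u :=
  Tau (Pi1Qtop X x₀)

end Tau

/-! As a group, π₁(Σ(X₊)) is free on the set π₀(X), with the circles through the components as
basis; the theorem compares topologies on this group.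

1 → 2: a Hausdorff topological group is completely regular, and the identity π₁^qtop → π₁^τ is a
continuous injection. 2 → 3: sending a component to its circle is a continuous injection π₀^qtop(X)
→ π₁^qtop. 3 → 1: `GeneralizedWedge.holonomy` is a continuous injective homomorphism from π₁^qtop to
F_M(π₀^qtop(X)). It stays continuous on π₁^τ (`Tau.continuous_of_monoidHom`), and its target is
Hausdorff (`FreeTopGroup.t2Space`).

The holonomy is that of a flat bundle with two charts, the complement of the basepoint and the
complement of the level 1/2; the transition function is 1 below that level and [x] above it. Since X
is arbitrary, flatness is required only along paths. Injectivity holds because the circles generate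
π₁ (`circleHom_surjective`) and holonomy sends them to the free basis. The free group is separated
by a pseudometric built from thresholds of real functions. -/

/-! ### Holonomy of flat bundles along paths. -/

open Set Topology Filter in
/-- Every path can be subdivided into finitely many pieces each lying in a member of a given open
cover. -/
theorem Path.exists_subdivision {B ι : Type*} [TopologicalSpace B] {x y : B} (γ : Path x y)
    {W : ι → Set B} (hW : ∀ i, IsOpen (W i)) (hc : ∀ b, ∃ i, b ∈ W i) :
    ∃ (t : ℕ → I) (j : ℕ → ι) (N : ℕ), t 0 = 0 ∧ Monotone t ∧ t N = 1 ∧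
      ∀ n, MapsTo γ (Icc (t n) (t (n + 1))) (W (j n)) := by
  obtain ⟨t, h0, hm, ⟨N, hN⟩, hsub⟩ := exists_monotone_Icc_subset_open_cover_unitInterval
    (c := fun i => γ ⁻¹' W i) (fun i => (hW i).preimage γ.continuous)
    (fun s _ => by simpa using hc (γ s))
  choose j hj using hsub
  exact ⟨t, j, N, h0, hm, hN N le_rfl, hj⟩

/-- An open cover of `B` with an `H`-valued gauge on each of its members, such that the transition
functions between gauges are constant along paths. This is a flat `H`-bundle over `B`, as far as
paths in `B` can see. -/
structure PathCocycle (B : Type u) [TopologicalSpace B] (ι : Type*) (H : Type v) [Group H] where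
  cover : ι → Set B
  gauge : ι → B → H
  isOpen_cover : ∀ i, IsOpen (cover i)
  exists_mem_cover : ∀ b, ∃ i, b ∈ cover i
  transition_eq : ∀ i j {x y : B} (p : Path x y), (∀ s, p s ∈ cover i ∩ cover j) →
    (gauge i x)⁻¹ * gauge j x = (gauge i y)⁻¹ * gauge j y

namespace PathCocycle

open Set Topology Filter

variable {B : Type u} [TopologicalSpace B] {ι : Type*} {H : Type v} [Group H]
  (c : PathCocycle B ι H)

/-- The transition function between two gauges. -/
def transition (i j : ι) (b : B) : H := (c.gauge i b)⁻¹ * c.gauge j b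

/-- `G` is a flat section along `γ` up to time `u`. -/
def IsFlat (γ : I → B) (G : I → H) (u : I) : Prop :=
  ∀ i a b, a ≤ b → b ≤ u → MapsTo γ (Icc a b) (c.cover i) →
    (c.gauge i (γ a))⁻¹ * G a = (c.gauge i (γ b))⁻¹ * G b

variable {c}

theorem transition_eq_of_mapsTo {x y : B} (γ : Path x y) {a b : I} (hab : a ≤ b) {i j : ι}
    (hi : MapsTo γ (Icc a b) (c.cover i)) (hj : MapsTo γ (Icc a b) (c.cover j)) :
    c.transition i j (γ a) = c.transition i j (γ b) := by
  refine c.transition_eq i j (γ.subpath a b) fun s => ?_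
  have hs : γ.subpath a b s ∈ γ '' Icc a b := by
    rw [← Path.range_subpath_of_le γ a b hab]
    exact mem_range_self s
  obtain ⟨r, hr, h⟩ := hs
  rw [← h]
  exact ⟨hi hr, hj hr⟩

/-- The continuation is chosen so that it is constant when read in gauge `j`. It is then constant in
every other gauge, because transition functions are constant along paths. -/
theorem IsFlat.extend {x y : B} {γ : Path x y} {G : I → H} {u v : I} (hG : c.IsFlat γ G u)
    {j : ι} (hj : MapsTo γ (Icc u v) (c.cover j)) :
    c.IsFlat γ (fun s => if s ≤ u then G s else
      c.gauge j (γ s) * (c.gauge j (γ u))⁻¹ * G u) v := by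
  intro i a b hab hbv hi
  have key : ∀ s t, u ≤ s → s ≤ t → t ≤ v → MapsTo γ (Icc s t) (c.cover i) →
      (c.gauge i (γ s))⁻¹ * c.gauge j (γ s) = (c.gauge i (γ t))⁻¹ * c.gauge j (γ t) :=
    fun s t hs hst ht hm => transition_eq_of_mapsTo γ hst hm
      (hj.mono_left (Icc_subset_Icc hs ht))
  rcases le_or_gt b u with hb | hb
  · simpa only [hb, hab.trans hb, if_true] using hG i a b hab hb hi
  · rcases le_or_gt a u with ha | ha
    · simp only [ha, if_true, not_le.2 hb, if_false]
      rw [hG i a u ha le_rfl (hi.mono_left (Icc_subset_Icc le_rfl hb.le))]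
      have := key u b le_rfl hb.le hbv (hi.mono_left (Icc_subset_Icc ha le_rfl))
      rw [← mul_assoc, ← mul_assoc, ← this]
      group
    · simp only [not_le.2 ha, not_le.2 hb, if_false]
      have := key a b ha.le hab hbv hi
      rw [← mul_assoc, ← mul_assoc, this, mul_assoc, mul_assoc, mul_assoc]

theorem exists_isFlat {x y : B} (γ : Path x y) : ∃ G, c.IsFlat γ G 1 := by
  obtain ⟨t, j, N, h0, hm, hN, hj⟩ := γ.exists_subdivision c.isOpen_cover c.exists_mem_cover
  have : ∀ n, ∃ G, c.IsFlat γ G (t n) := by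
    intro n
    induction n with
    | zero =>
      refine ⟨fun _ => 1, fun i a b hab hb _ => ?_⟩
      rw [h0] at hb
      have hb' : b = 0 := le_antisymm hb unitInterval.nonneg'
      have ha' : a = 0 := le_antisymm (hab.trans hb) unitInterval.nonneg'
      rw [ha', hb']
    | succ n ih =>
      obtain ⟨G, hG⟩ := ih
      exact ⟨_, hG.extend (hj n)⟩
  simpa only [hN] using this N

/-- A flat section is determined up to right multiplication by a constant, which cancels in `G 1 *
(G 0)⁻¹`. -/
theorem IsFlat.unique {x y : B} {γ : Path x y} {G G' : I → H} (hG : c.IsFlat γ G 1)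
    (hG' : c.IsFlat γ G' 1) : G 1 * (G 0)⁻¹ = G' 1 * (G' 0)⁻¹ := by
  obtain ⟨t, j, N, h0, hm, hN, hj⟩ := γ.exists_subdivision c.isOpen_cover c.exists_mem_cover
  have : ∀ n, G (t n) * (G 0)⁻¹ = G' (t n) * (G' 0)⁻¹ := by
    intro n
    induction n with
    | zero => simp [h0]
    | succ n ih =>
      have h1 := hG (j n) _ _ (hm n.le_succ) unitInterval.le_one' (hj n)
      have h2 := hG' (j n) _ _ (hm n.le_succ) unitInterval.le_one' (hj n)
      rw [← mul_right_inj (c.gauge (j n) (γ (t (n + 1))))⁻¹, ← mul_assoc, ← mul_assoc, ← h1,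
        ← h2, mul_assoc, mul_assoc, ih]
  simpa only [hN] using this N

theorem IsFlat.comp {γ δ : I → B} {G : I → H} (hG : c.IsFlat γ G 1) {f : I → I}
    (hf : Continuous f) (hm : Monotone f) (h : ∀ s, γ (f s) = δ s) :
    c.IsFlat δ (G ∘ f) 1 := by
  intro i a b hab _ hi
  rw [← h, ← h]
  refine hG i _ _ (hm hab) unitInterval.le_one' fun s hs => ?_
  obtain ⟨r, hr, rfl⟩ := intermediate_value_Icc hab hf.continuousOn hs
  rw [h]
  exact hi hr

variable (c)

/-- The holonomy of a path. -/
noncomputable def holonomy {x y : B} (γ : Path x y) : H :=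
  (c.exists_isFlat γ).choose 1 * ((c.exists_isFlat γ).choose 0)⁻¹

variable {c}

theorem IsFlat.holonomy_eq {x y : B} {γ : Path x y} {G : I → H} (hG : c.IsFlat γ G 1) :
    c.holonomy γ = G 1 * (G 0)⁻¹ :=
  (c.exists_isFlat γ).choose_spec.unique hG

/-- The two halves of a flat section along the concatenation share the value at 1/2, which
telescopes. The reversed order is that of the group law, see `Pi1Qtop.mk_trans`. -/
theorem holonomy_trans {x y z : B} (γ : Path x y) (δ : Path y z) :
    c.holonomy (γ.trans δ) = c.holonomy δ * c.holonomy γ := by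
  obtain ⟨G, hG⟩ := c.exists_isFlat (γ.trans δ)
  let h : I := ⟨1 / 2, by norm_num, by norm_num⟩
  have h₁ : c.IsFlat γ (G ∘ fun s => ⟨(s : ℝ) / 2, by have := s.2.1; positivity,
      by have := s.2.2; linarith⟩) 1 := by
    refine hG.comp (by fun_prop) (fun a b hab => ?_) fun s => ?_
    · have : (a : ℝ) ≤ b := hab
      exact Subtype.mk_le_mk.2 (by linarith)
    · rw [Path.trans_apply, dif_pos (by have := s.2.2; simp only; linarith)]
      congr 1
      ext
      simp only
      ring
  have h₂ : c.IsFlat δ (G ∘ fun s => ⟨(1 + (s : ℝ)) / 2, by have := s.2.1; positivity,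
      by have := s.2.2; linarith⟩) 1 := by
    refine hG.comp (by fun_prop) (fun a b hab => ?_) fun s => ?_
    · have : (a : ℝ) ≤ b := hab
      exact Subtype.mk_le_mk.2 (by linarith)
    · rw [Path.trans_apply]
      split_ifs with hs
      · have hs' : s = 0 := by
          ext
          have := s.2.1
          simp only [Icc.coe_zero] at *
          linarith
        subst hs'
        rw [δ.source]
        convert γ.target
        simp
      · congr 1
        ext
        simp only
        ring
  rw [hG.holonomy_eq, h₁.holonomy_eq, h₂.holonomy_eq]
  have e0 : (⟨((0 : I) : ℝ) / 2, by simp, by simp⟩ : I) = 0 := by ext; simp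
  have e1 : (⟨((1 : I) : ℝ) / 2, by simp, by norm_num⟩ : I) = h := by ext; simp [h]
  have e2 : (⟨(1 + ((0 : I) : ℝ)) / 2, by simp, by norm_num⟩ : I) = h := by ext; simp [h]
  have e3 : (⟨(1 + ((1 : I) : ℝ)) / 2, by norm_num, by norm_num⟩ : I) = 1 := by
    ext; norm_num
  simp only [Function.comp_apply, e0, e1, e2, e3]
  group

/-- Holonomy depends continuously on the path, if the transition functions are continuous. -/
theorem continuous_holonomy [TopologicalSpace H] [ContinuousMul H] {A : Type*}
    [TopologicalSpace A] {x y : B} {Γ : A → Path x y} (hΓ : Continuous Γ)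
    (h : ∀ i j s, ContinuousOn (fun a => c.transition i j (Γ a s))
      {a | Γ a s ∈ c.cover i ∩ c.cover j}) :
    Continuous fun a => c.holonomy (Γ a) := by
  rw [continuous_iff_continuousAt]
  intro a₀
  obtain ⟨t, j, N, h0, hm, hN, hj⟩ :=
    (Γ a₀).exists_subdivision c.isOpen_cover c.exists_mem_cover
  choose G hG using fun a => c.exists_isFlat (Γ a)
  -- Sending a compact interval into an open set is an open condition in the compact-open topology,
  -- so the subdivision for `a₀` serves nearby `a`.
  have hnear : ∀ n, ∀ᶠ a in 𝓝 a₀, MapsTo (Γ a) (Icc (t n) (t (n + 1))) (c.cover (j n)) := by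
    intro n
    have hc : Continuous fun a => (Γ a : C(I, B)) := continuous_induced_dom.comp hΓ
    exact hc.continuousAt.eventually
      ((ContinuousMap.isOpen_setOfPred_mapsTo isCompact_Icc
        (c.isOpen_cover (j n))).mem_nhds (hj n))
  -- The sections `G a` are chosen independently for each `a`; only the normalized value `G a t * (G
  -- a 0)⁻¹` can vary continuously. Passing from one piece to the next multiplies its reading by a
  -- transition function.
  have key : ∀ n, ContinuousAt
      (fun a => (c.gauge (j n) (Γ a (t n)))⁻¹ * (G a (t n) * (G a 0)⁻¹)) a₀ := by
    intro n
    induction n with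
    | zero =>
      simp only [h0, Path.source, mul_inv_cancel]
      exact continuousAt_const
    | succ n ih =>
      have hr : ContinuousAt (fun a => c.transition (j (n + 1)) (j n) (Γ a (t (n + 1)))) a₀ := by
        refine (h _ _ _).continuousAt ?_
        have hev : Continuous fun a => Γ a (t (n + 1)) := by fun_prop
        exact (((c.isOpen_cover _).inter (c.isOpen_cover _)).preimage hev).mem_nhds
          ⟨hj (n + 1) ⟨le_rfl, hm (Nat.le_succ _)⟩, hj n ⟨hm (Nat.le_succ _), le_rfl⟩⟩
      refine (hr.mul ih).congr ?_
      filter_upwards [hnear n] with a ha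
      have := hG a (j n) _ _ (hm n.le_succ) unitInterval.le_one' ha
      simp only [Pi.mul_apply]
      rw [← mul_assoc _ (G a (t n)), this, transition]
      group
  have hlast : ContinuousAt
      (fun a => c.gauge (j N) y * ((c.gauge (j N) (Γ a (t N)))⁻¹ * (G a (t N) * (G a 0)⁻¹)))
      a₀ := continuousAt_const.mul (key N)
  refine hlast.congr (Eventually.of_forall fun a => ?_)
  simp only [hN, Path.target, mul_inv_cancel_left]
  exact (hG a).holonomy_eq.symm

/-- With the discrete topology on `H`, the transition functions are locally constant along the paths
`a ↦ F (a, s)`. Holonomy is then a continuous map from the connected interval to a discrete space.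
-/
theorem holonomy_eq_of_homotopic {x y : B} {γ δ : Path x y} (h : γ.Homotopic δ) :
    c.holonomy γ = c.holonomy δ := by
  obtain ⟨F⟩ := h
  let _ : TopologicalSpace H := ⊥
  have _ : DiscreteTopology H := ⟨rfl⟩
  have hF : Continuous F.eval := by
    rw [← Path.continuous_uncurry_iff]
    exact F.continuous
  have hc : Continuous fun a => c.holonomy (F.eval a) := by
    refine continuous_holonomy hF fun i j s => ?_
    let η : Path (F (0, s)) (F (1, s)) :=
      { toFun := fun a => F (a, s)
        source' := rfl
        target' := rfl }
    have hO : IsOpen (η ⁻¹' (c.cover i ∩ c.cover j)) :=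
      ((c.isOpen_cover i).inter (c.isOpen_cover j)).preimage η.continuous
    intro a₀ ha₀
    refine ContinuousAt.continuousWithinAt ?_
    refine (continuousAt_const (y := c.transition i j (η a₀))).congr ?_
    have hu : ∀ᶠ a in 𝓝 a₀, uIcc a₀ a ⊆ η ⁻¹' (c.cover i ∩ c.cover j) :=
      (tendsto_const_nhds.uIcc tendsto_id).eventually
        (eventually_smallSets_subset.2 (hO.mem_nhds ha₀))
    filter_upwards [hu] with a ha
    refine c.transition_eq i j (η.subpath a₀ a) fun r => ?_
    have hs : η.subpath a₀ a r ∈ η '' uIcc a₀ a := by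
      rw [← Path.range_subpath]
      exact mem_range_self r
    obtain ⟨q, hq, h⟩ := hs
    have hmem := ha hq
    rw [mem_preimage, h] at hmem
    exact hmem
  have := PreconnectedSpace.constant inferInstance hc (x := 0) (y := 1)
  simpa using this

/-- The holonomy homomorphism on the fundamental group. -/
noncomputable def holonomyHom (c : PathCocycle B ι H) (x : B) : Pi1Qtop B x →* H :=
  MonoidHom.mk' (fun p => Quotient.lift (fun γ : Path x x => c.holonomy γ)
    (fun _ _ h => holonomy_eq_of_homotopic h) (FundamentalGroup.toPath p)) (by
      intro p q
      induction p using Path.Homotopic.Quotient.ind with | mk γ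
      induction q using Path.Homotopic.Quotient.ind with | mk δ
      exact holonomy_trans δ γ)

end PathCocycle

/-! ### The flat bundle over Σ(X₊) and its monodromy. -/

namespace GeneralizedWedge

open Set Topology Filter

variable {X : Type u} [TopologicalSpace X]

/-- The canonical map `X × I → Σ(X₊)`. -/
def point (p : X × I) : GeneralizedWedge X :=
  Quotient.mk (suspensionSetoid (X ⊕ PUnit.{u + 1}) (Sum.inr PUnit.unit)) (Sum.inl p.1, p.2)

theorem point_zero (x : X) : point (x, 0) = base X :=
  Quotient.sound (Or.inr ⟨Or.inl rfl, Or.inl rfl⟩)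

theorem point_one (x : X) : point (x, 1) = base X :=
  Quotient.sound (Or.inr ⟨Or.inr (Or.inl rfl), Or.inl rfl⟩)

theorem continuous_point : Continuous (point (X := X)) := by
  have : Continuous fun p : X × I => ((Sum.inl p.1, p.2) : (X ⊕ PUnit.{u + 1}) × I) := by
    fun_prop
  exact continuous_quotient_mk'.comp this

theorem eq_base_or_exists (b : GeneralizedWedge X) : b = base X ∨ ∃ p, point p = b := by
  induction b using Quotient.inductionOn with | h p
  obtain ⟨x | ⟨⟩, t⟩ := p
  · exact Or.inr ⟨(x, t), rfl⟩
  · exact Or.inl (Quotient.sound (Or.inr ⟨Or.inr (Or.inr rfl), Or.inl rfl⟩))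

/-- The summand `{∗} × I` collapses to the basepoint, so its part of the preimage is everything or
empty. This covers empty `X`, where `point` is not surjective. -/
theorem isOpen_iff {O : Set (GeneralizedWedge X)} : IsOpen O ↔ IsOpen (point ⁻¹' O) := by
  refine ⟨fun h => h.preimage continuous_point, fun h => ?_⟩
  change IsOpen (Quotient.mk (suspensionSetoid (X ⊕ PUnit.{u + 1}) (Sum.inr PUnit.unit)) ⁻¹' O)
  rw [← (Homeomorph.sumProdDistrib (X := X) (Y := PUnit.{u + 1}) (Z := I)).symm.isOpen_preimage,
    isOpen_sum_iff]
  refine ⟨h, ?_⟩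
  have hb : ∀ p : PUnit.{u + 1} × I, Quotient.mk
      (suspensionSetoid (X ⊕ PUnit.{u + 1}) (Sum.inr PUnit.unit)) (Sum.inr p.1, p.2) = base X :=
    fun p => Quotient.sound (Or.inr ⟨Or.inr (Or.inr rfl), Or.inl rfl⟩)
  by_cases hO : base X ∈ O
  · convert isOpen_univ
    ext p
    exact ⟨fun _ => trivial, fun _ => (congrArg (· ∈ O) (hb p)).mpr hO⟩
  · convert isOpen_empty
    ext p
    exact ⟨fun hp => hO ((congrArg (· ∈ O) (hb p)).mp hp), fun hp => hp.elim⟩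

theorem isQuotientMap_point [Nonempty X] : IsQuotientMap (point (X := X)) := by
  refine ⟨IsCoinducing.of_isOpen_preimage_iff_isOpen fun O => isOpen_iff.symm, fun b => ?_⟩
  rcases eq_base_or_exists b with rfl | h
  · exact ⟨(Classical.arbitrary X, 0), point_zero _⟩
  · exact h

open Classical in
/-- The coordinates of a point of `Σ(X₊)` other than the basepoint. -/
noncomputable def coord : GeneralizedWedge X → Option (X × I) :=
  Quotient.lift (fun p => p.1.elim
    (fun x => if p.2 = 0 ∨ p.2 = 1 then none else some (x, p.2)) fun _ => none) (by
      have key : ∀ p ∈ suspensionCollapsed (X ⊕ PUnit.{u + 1}) (Sum.inr PUnit.unit),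
          p.1.elim (fun x => if p.2 = 0 ∨ p.2 = 1 then none else some (x, p.2))
            (fun _ => none) = none := by
        rintro ⟨x | ⟨⟩, t⟩ hp
        · simp only [suspensionCollapsed, mem_ofPred_eq, reduceCtorEq, or_false] at hp
          simp [hp]
        · rfl
      rintro p q (rfl | ⟨hp, hq⟩)
      · rfl
      · rw [key p hp, key q hq])

theorem coord_point {p : X × I} (h0 : p.2 ≠ 0) (h1 : p.2 ≠ 1) : coord (point p) = some p :=
  if_neg (by simp [h0, h1])

theorem coord_base : coord (base X) = none := rfl

variable (X) in
/-- The complement of the basepoint. -/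
def punctured : Set (GeneralizedWedge X) := {b | ∃ p, coord b = some p}

variable (X) in
/-- The complement of the middle level `X × {1/2}`. -/
def offMiddle : Set (GeneralizedWedge X) := {b | ∀ p, coord b = some p → (p.2 : ℝ) ≠ 1 / 2}

theorem point_mem_punctured {p : X × I} : point p ∈ punctured X ↔ p.2 ≠ 0 ∧ p.2 ≠ 1 := by
  constructor
  · rintro ⟨q, hq⟩
    by_contra h
    rw [not_and_or, not_ne_iff, not_ne_iff] at h
    have : point p = base X := by
      rcases h with h | h
      · rw [show p = (p.1, 0) from Prod.ext rfl h, point_zero]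
      · rw [show p = (p.1, 1) from Prod.ext rfl h, point_one]
    rw [this, coord_base] at hq
    cases hq
  · rintro ⟨h0, h1⟩
    exact ⟨p, coord_point h0 h1⟩

theorem point_mem_offMiddle {p : X × I} : point p ∈ offMiddle X ↔ (p.2 : ℝ) ≠ 1 / 2 := by
  constructor
  · intro h hp
    refine h p (coord_point ?_ ?_) hp
    · intro h0
      rw [h0] at hp
      norm_num at hp
    · intro h1
      rw [h1] at hp
      norm_num at hp
  · intro hp q hq
    by_cases h : p.2 ≠ 0 ∧ p.2 ≠ 1
    · rw [coord_point h.1 h.2] at hq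
      cases hq
      exact hp
    · exact absurd ⟨q, hq⟩ (mt point_mem_punctured.1 h)

theorem isOpen_punctured : IsOpen (punctured X) := by
  rw [isOpen_iff]
  have : point ⁻¹' punctured X = {p : X × I | p.2 ≠ 0} ∩ {p | p.2 ≠ 1} := by
    ext p
    exact point_mem_punctured
  rw [this]
  exact (isOpen_ne_fun continuous_snd continuous_const).inter
    (isOpen_ne_fun continuous_snd continuous_const)

theorem isOpen_offMiddle : IsOpen (offMiddle X) := by
  rw [isOpen_iff]
  have : point ⁻¹' offMiddle X = {p : X × I | (p.2 : ℝ) ≠ 1 / 2} := by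
    ext p
    exact point_mem_offMiddle
  rw [this]
  exact isOpen_ne_fun (by fun_prop) continuous_const

theorem continuousOn_of_comp_point {Y : Type*} [TopologicalSpace Y] {f : GeneralizedWedge X → Y}
    {O : Set (GeneralizedWedge X)} (hO : IsOpen O) (hO' : O ⊆ punctured X)
    (hf : ContinuousOn (f ∘ point) (point ⁻¹' O)) : ContinuousOn f O := by
  rcases isEmpty_or_nonempty X with hX | hX
  · intro b hb
    obtain ⟨p, -⟩ := hO' hb
    exact hX.elim p.1
  · exact (isQuotientMap_point.continuousOn_isOpen_iff hO).2 hf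

/-- The `X`-coordinate, with value `x₀` at the basepoint. -/
noncomputable def proj (x₀ : X) (b : GeneralizedWedge X) : X := (coord b).elim x₀ Prod.fst

/-- The `I`-coordinate, with value `0` at the basepoint. -/
noncomputable def height (b : GeneralizedWedge X) : I := (coord b).elim 0 Prod.snd

theorem continuousOn_proj (x₀ : X) : ContinuousOn (proj x₀) (punctured X) := by
  refine continuousOn_of_comp_point isOpen_punctured subset_rfl ?_
  refine continuous_fst.continuousOn.congr fun p hp => ?_
  obtain ⟨h0, h1⟩ := point_mem_punctured.1 hp
  simp [proj, coord_point h0 h1]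

theorem continuousOn_height : ContinuousOn height (punctured X) := by
  refine continuousOn_of_comp_point isOpen_punctured subset_rfl ?_
  refine continuous_snd.continuousOn.congr fun p hp => ?_
  obtain ⟨h0, h1⟩ := point_mem_punctured.1 hp
  simp [height, coord_point h0 h1]

/-- The gauge over the complement of the basepoint: trivial on the lower half, and the canonical
generators on the upper half. -/
noncomputable def upperGauge (b : GeneralizedWedge X) : FreeTopGroup (ZerothHomotopy X) :=
  (coord b).elim 1 fun p => if (1 / 2 : ℝ) < p.2 then FreeTopGroup.of (ZerothHomotopy.mk p.1) else 1

theorem upperGauge_eq (x₀ : X) {b : GeneralizedWedge X} (hb : b ∈ punctured X) :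
    upperGauge b =
      if (1 / 2 : ℝ) < height b then FreeTopGroup.of (ZerothHomotopy.mk (proj x₀ b)) else 1 := by
  obtain ⟨p, hp⟩ := hb
  simp [upperGauge, height, proj, hp]

theorem continuousOn_upperGauge :
    ContinuousOn (upperGauge (X := X)) (punctured X ∩ offMiddle X) := by
  refine continuousOn_of_comp_point (isOpen_punctured.inter isOpen_offMiddle) inter_subset_left ?_
  have hf : ContinuousOn (fun p : X × I => if (1 / 2 : ℝ) < p.2 then
      FreeTopGroup.of (ZerothHomotopy.mk p.1) else 1) {p | (p.2 : ℝ) ≠ 1 / 2} := by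
    intro p hp
    refine ContinuousAt.continuousWithinAt ?_
    rcases lt_or_gt_of_ne hp with h | h
    · refine (continuousAt_const (y := 1)).congr ?_
      have : ∀ᶠ q : X × I in 𝓝 p, (q.2 : ℝ) < 1 / 2 :=
        (isOpen_lt (by fun_prop) continuous_const).mem_nhds h
      filter_upwards [this] with q hq
      exact (if_neg (not_lt.2 hq.le)).symm
    · have hc : Continuous fun p : X × I => FreeTopGroup.of (ZerothHomotopy.mk p.1) :=
        (FreeTopGroup.continuous_of _).comp
          (ZerothHomotopy.isQuotientMap_mk.continuous.comp continuous_fst)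
      refine hc.continuousAt.congr ?_
      have : ∀ᶠ q : X × I in 𝓝 p, 1 / 2 < (q.2 : ℝ) :=
        (isOpen_lt continuous_const (by fun_prop)).mem_nhds h
      filter_upwards [this] with q hq
      exact (if_pos hq).symm
  refine (hf.mono fun p hp => point_mem_offMiddle.1 hp.2).congr fun p hp => ?_
  obtain ⟨h0, h1⟩ := point_mem_punctured.1 hp.1
  simp [upperGauge, coord_point h0 h1]

/-- Such a path has a continuous `X`-coordinate, hence stays in one path component, and by the
intermediate value theorem it stays on one side of level 1/2. -/
theorem upperGauge_eq_of_path {a b : GeneralizedWedge X} (p : Path a b)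
    (hp : ∀ s, p s ∈ punctured X ∩ offMiddle X) : upperGauge a = upperGauge b := by
  have ha : a ∈ punctured X := p.source ▸ (hp 0).1
  have hb : b ∈ punctured X := p.target ▸ (hp 1).1
  obtain ⟨⟨x₀, -⟩, -⟩ := id ha
  have hr : range p ⊆ punctured X := by
    rintro _ ⟨s, rfl⟩
    exact (hp s).1
  have hx : ZerothHomotopy.mk (proj x₀ a) = ZerothHomotopy.mk (proj x₀ b) :=
    Quotient.sound ⟨p.map' ((continuousOn_proj x₀).mono hr)⟩
  have hc : Continuous fun s => (height (p s) : ℝ) :=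
    continuous_subtype_val.comp
      (continuousOn_height.comp_continuous p.continuous fun s => (hp s).1)
  have hne : ∀ s, (height (p s) : ℝ) ≠ 1 / 2 := by
    intro s
    obtain ⟨⟨q, hq⟩, hm⟩ := hp s
    have := hm q hq
    simpa [height, hq] using this
  have hside : ∀ s t, (1 / 2 : ℝ) < height (p s) → (1 / 2 : ℝ) < height (p t) := by
    intro s t hs
    by_contra ht
    obtain ⟨r, hr⟩ := mem_range_of_exists_le_of_exists_ge hc ⟨t, not_lt.1 ht⟩ ⟨s, hs.le⟩
    exact hne r hr
  have h01 : (1 / 2 : ℝ) < height a ↔ (1 / 2 : ℝ) < height b := by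
    have h := hside 0 1
    have h' := hside 1 0
    rw [p.source, p.target] at h h'
    exact ⟨h, h'⟩
  simp only [upperGauge_eq x₀ ha, upperGauge_eq x₀ hb, hx, h01]

variable (X) in
/-- The tautological flat bundle over `Σ(X₊)`, with monodromy `[x]` along the circle through `x`. -/
noncomputable def cocycle : PathCocycle (GeneralizedWedge X) Bool (FreeTopGroup (ZerothHomotopy X))
    where
  cover i := if i then punctured X else offMiddle X
  gauge i := if i then upperGauge else fun _ => 1
  isOpen_cover i := by
    cases i
    exacts [isOpen_offMiddle, isOpen_punctured]
  exists_mem_cover b := by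
    by_cases hb : b ∈ punctured X
    · exact ⟨true, hb⟩
    · exact ⟨false, fun p hp => absurd ⟨p, hp⟩ hb⟩
  transition_eq i j a b p hp := by
    cases i <;> cases j
    · simp
    · simpa using upperGauge_eq_of_path p fun s => ⟨(hp s).2, (hp s).1⟩
    · simpa using upperGauge_eq_of_path p fun s => ⟨(hp s).1, (hp s).2⟩
    · simp

theorem continuousOn_transition (i j : Bool) :
    ContinuousOn ((cocycle X).transition i j) ((cocycle X).cover i ∩ (cocycle X).cover j) := by
  have h := continuousOn_upperGauge (X := X)
  cases i <;> cases j
  · exact (continuousOn_const (c := 1)).congr fun b _ => by simp [PathCocycle.transition, cocycle]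
  · rw [inter_comm]
    exact h.congr fun b _ => by simp [PathCocycle.transition, cocycle]
  · exact h.inv.congr fun b _ => by simp [PathCocycle.transition, cocycle]
  · exact (continuousOn_const (c := 1)).congr fun b _ => by simp [PathCocycle.transition, cocycle]

variable (X) in
/-- The holonomy homomorphism `π₁(Σ(X₊)) → F(π₀(X))`. -/
noncomputable def holonomy :
    Pi1Qtop (GeneralizedWedge X) (base X) →* FreeTopGroup (ZerothHomotopy X) :=
  (cocycle X).holonomyHom (base X)

theorem continuous_holonomy : Continuous (holonomy X) := by
  refine continuous_coinduced_dom.2 ?_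
  refine PathCocycle.continuous_holonomy continuous_id fun i j s => ?_
  refine (continuousOn_transition i j).comp (Continuous.continuousOn ?_) fun _ h => h
  fun_prop

/-- The loop in `Σ(X₊)` running along the circle through `x`. -/
def circleLoop (x : X) : Path (base X) (base X) where
  toFun s := point (x, s)
  continuous_toFun := continuous_point.comp (by fun_prop)
  source' := point_zero x
  target' := point_one x

theorem continuous_circleLoop : Continuous (circleLoop (X := X)) := by
  rw [← Path.continuous_uncurry_iff]
  exact continuous_point

theorem holonomy_circleLoop (x : X) :
    holonomy X (Pi1Qtop.mk _ _ (circleLoop x)) = FreeTopGroup.of (ZerothHomotopy.mk x) := by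
  -- The section jumps at 1/2 together with `upperGauge`; an interval inside the other chart misses
  -- 1/2, so the section is constant there.
  have hflat : (cocycle X).IsFlat (circleLoop x)
      (fun s => if (1 / 2 : ℝ) < s then FreeTopGroup.of (ZerothHomotopy.mk x) else 1) 1 := by
    intro i a b hab _ hm
    cases i
    · have key : (1 / 2 : ℝ) < a ↔ (1 / 2 : ℝ) < b := by
        have hab' : (a : ℝ) ≤ b := hab
        refine ⟨fun h => h.trans_le hab', fun h => ?_⟩
        by_contra ha
        have hmem := hm (x := ⟨1 / 2, by norm_num, by norm_num⟩) ⟨not_lt.1 ha, h.le⟩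
        exact point_mem_offMiddle.1 hmem rfl
      simp only [cocycle, key]
      rfl
    · have key : ∀ s ∈ Icc a b, upperGauge (circleLoop x s) =
          if (1 / 2 : ℝ) < s then FreeTopGroup.of (ZerothHomotopy.mk x) else 1 := by
        intro s hs
        have hmem : point (x, s) ∈ punctured X := hm hs
        obtain ⟨h0, h1⟩ := point_mem_punctured.1 hmem
        change upperGauge (point (x, s)) = _
        simp [upperGauge, coord_point h0 h1]
      simp only [cocycle, if_true, key a ⟨le_rfl, hab⟩, key b ⟨hab, le_rfl⟩, inv_mul_cancel]
  refine hflat.holonomy_eq.trans ?_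
  norm_num

end GeneralizedWedge

/-! ### The circles generate π₁(Σ(X₊)). -/

namespace GeneralizedWedge

open Set Topology Filter

variable {X : Type u} [TopologicalSpace X]

instance : ContractibleSpace I :=
  (convex_Icc (0 : ℝ) 1).contractibleSpace ⟨0, by simp⟩

theorem point_eq_base {p : X × I} (h : point p = base X) : p.2 = 0 ∨ p.2 = 1 := by
  by_contra hp
  rw [not_or] at hp
  have := coord_point hp.1 hp.2
  rw [h, coord_base] at this
  cases this

theorem point_eq_base_of {x : X} {t : I} (h : t = 0 ∨ t = 1) : point (x, t) = base X := by
  rcases h with rfl | rfl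
  exacts [point_zero x, point_one x]

theorem circleLoop_homotopic {x y : X} (h : Joined x y) :
    (circleLoop x).Homotopic (circleLoop y) := by
  obtain ⟨p⟩ := h
  exact ⟨{ toFun := fun q => point (p q.1, q.2)
           continuous_toFun := continuous_point.comp (by fun_prop)
           map_zero_left := fun s => by simp [circleLoop]
           map_one_left := fun s => by simp [circleLoop]
           prop' := by
            rintro t s (rfl | rfl)
            · exact (point_zero _).trans (point_zero x).symm
            · exact (point_one _).trans (point_one x).symm }⟩

variable (X) in
/-- The map `π₀(X) → π₁(Σ(X₊))` sending the component of `x` to the circle through `x`. -/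
def circleClass : ZerothHomotopy X → Pi1Qtop (GeneralizedWedge X) (base X) :=
  ZerothHomotopy.lift (fun x => Pi1Qtop.mk _ _ (circleLoop x))
    fun _ _ p => congrArg FundamentalGroup.fromPath
      (Path.Homotopic.Quotient.eq.2 (circleLoop_homotopic ⟨p⟩))

theorem continuous_circleClass : Continuous (circleClass X) :=
  ZerothHomotopy.isQuotientMap_mk.continuous_iff.2
    (continuous_coinduced_rng.comp continuous_circleLoop)

variable (X) in
/-- The homomorphism `F(π₀(X)) → π₁(Σ(X₊))`. -/
noncomputable def circleHom :
    FreeTopGroup (ZerothHomotopy X) →* Pi1Qtop (GeneralizedWedge X) (base X) :=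
  FreeTopGroup.lift (circleClass X)

theorem holonomy_circleClass (z : ZerothHomotopy X) :
    holonomy X (circleClass X z) = FreeTopGroup.of z := by
  induction z using ZerothHomotopy.rec with | mk x
  exact holonomy_circleLoop x

theorem holonomy_circleHom (w : FreeTopGroup (ZerothHomotopy X)) :
    holonomy X (circleHom X w) = w := by
  have : (holonomy X).comp (circleHom X) = MonoidHom.id _ := by
    refine FreeGroup.ext_hom _ _ fun z => ?_
    refine Eq.trans ?_ (holonomy_circleClass z)
    exact congrArg (holonomy X) FreeGroup.lift_apply_of
  exact DFunLike.congr_fun this w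

theorem mk_circleLoop_mem (x : X) : Pi1Qtop.mk _ _ (circleLoop x) ∈ (circleHom X).range :=
  ⟨FreeTopGroup.of (ZerothHomotopy.mk x), FreeGroup.lift_apply_of⟩

theorem _root_.Pi1Qtop.mk_eq_of_homotopic {B : Type u} [TopologicalSpace B] {x : B}
    {p q : Path x x} (h : p.Homotopic q) : Pi1Qtop.mk B x p = Pi1Qtop.mk B x q :=
  congrArg FundamentalGroup.fromPath (Path.Homotopic.Quotient.eq.2 h)

theorem _root_.Pi1Qtop.mk_trans {B : Type u} [TopologicalSpace B] {x : B} (p q : Path x x) :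
    Pi1Qtop.mk B x (p.trans q) = Pi1Qtop.mk B x q * Pi1Qtop.mk B x p := rfl

/-- The path `κ` in `Σ(X₊)` is the image of the path `(A, T)` in `X × I`. -/
def Lifts {b b' : GeneralizedWedge X} {x x' : X} {t t' : I} (κ : Path b b') (A : Path x x')
    (T : Path t t') : Prop :=
  ∀ s, κ s = point (A s, T s)

theorem Lifts.trans {b b' b'' : GeneralizedWedge X} {x x' x'' : X} {t t' t'' : I}
    {κ : Path b b'} {A : Path x x'} {T : Path t t'} {κ' : Path b' b''} {A' : Path x' x''}
    {T' : Path t' t''} (h : Lifts κ A T) (h' : Lifts κ' A' T') :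
    Lifts (κ.trans κ') (A.trans A') (T.trans T') := by
  intro s
  simp only [Path.trans_apply]
  split_ifs
  exacts [h _, h' _]

theorem Lifts.symm {b b' : GeneralizedWedge X} {x x' : X} {t t' : I} {κ : Path b b'}
    {A : Path x x'} {T : Path t t'} (h : Lifts κ A T) : Lifts κ.symm A.symm T.symm :=
  fun s => h (unitInterval.symm s)

/-- In `X × I`, first move along `A` at the fixed height `t`, then change the height over `x'`;
simple connectedness of `I` makes this homotopic to `(A, T)`. The first leg maps to the basepoint.
-/
theorem Lifts.homotopic {x x' : X} {t t' : I} {κ κ' : Path (base X) (base X)} {A : Path x x'}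
    {T T' : Path t t'} (h : Lifts κ A T) (ht : t = 0 ∨ t = 1)
    (h' : Lifts κ' (Path.refl x') T') : κ.Homotopic κ' := by
  have h₁ : (A.prod T).Homotopic ((A.prod (Path.refl t)).trans ((Path.refl x').prod T')) := by
    rw [Path.trans_prod_eq_prod_trans]
    obtain ⟨F⟩ : A.Homotopic (A.trans (Path.refl x')) := ⟨(Path.Homotopy.transRefl A).symm⟩
    obtain ⟨F'⟩ : T.Homotopic ((Path.refl t).trans T') := SimplyConnectedSpace.paths_homotopic _ _
    exact ⟨Path.Homotopic.prodHomotopy F F'⟩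
  have hs : base X = point (x, t) := (point_eq_base_of ht).symm
  have hs' : base X = point (x', t') := by
    have := h 1
    simpa using this
  have h₂ := (h₁.map ⟨point, continuous_point⟩).pathCast hs hs'
  have e₁ : ((A.prod T).map continuous_point).cast hs hs' = κ := by
    ext s
    exact (h s).symm
  have e₂ : (((A.prod (Path.refl t)).trans ((Path.refl x').prod T')).map continuous_point).cast
      hs hs' = (Path.refl (base X)).trans κ' := by
    ext s
    simp only [Path.cast_coe, Path.map_coe, Function.comp_apply, Path.trans_apply]
    split_ifs
    · exact point_eq_base_of ht
    · exact (h' _).symm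
  have h₃ : κ.Homotopic ((Path.refl (base X)).trans κ') := by
    rw [← e₁, ← e₂]
    exact h₂
  exact h₃.trans ⟨Path.Homotopy.reflTrans κ'⟩

theorem Lifts.mem_range {x x' : X} {t t' : I} {κ : Path (base X) (base X)} {A : Path x x'}
    {T : Path t t'} (h : Lifts κ A T) : Pi1Qtop.mk _ _ κ ∈ (circleHom X).range := by
  have ht : t = 0 ∨ t = 1 := by
    have := h 0
    simp only [Path.source] at this
    exact point_eq_base this.symm
  have ht' : t' = 0 ∨ t' = 1 := by
    have := h 1
    simp only [Path.target] at this
    exact point_eq_base this.symm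
  let E : Path (0 : I) 1 := { toFun := id, source' := rfl, target' := rfl }
  have hE : Lifts (circleLoop x') (Path.refl x') E := fun s => rfl
  have hrefl : Pi1Qtop.mk _ _ (Path.refl (base X)) ∈ (circleHom X).range := one_mem _
  -- Only the end heights matter: the loop is null-homotopic if they agree, and otherwise the circle
  -- through `x'` or its inverse.
  rcases ht with rfl | rfl <;> rcases ht' with rfl | rfl
  · rw [Pi1Qtop.mk_eq_of_homotopic (h.homotopic (Or.inl rfl) (κ' := Path.refl _)
      (T' := Path.refl _) fun s => (point_zero x').symm)]
    exact hrefl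
  · rw [Pi1Qtop.mk_eq_of_homotopic (h.homotopic (Or.inl rfl) hE)]
    exact mk_circleLoop_mem x'
  · rw [Pi1Qtop.mk_eq_of_homotopic (h.homotopic (Or.inr rfl) hE.symm)]
    exact inv_mem (mk_circleLoop_mem x')
  · rw [Pi1Qtop.mk_eq_of_homotopic (h.homotopic (Or.inr rfl) (κ' := Path.refl _)
      (T' := Path.refl _) fun s => (point_one x').symm)]
    exact hrefl

/-- A path starting at the basepoint becomes a product of circles when completed to a loop by any
path in a fibre of `X × I → X`. -/
def ClosesUp {b : GeneralizedWedge X} (η : Path (base X) b) : Prop :=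
  ∀ (x : X) (t t' : I) (T : Path t t') (δ : Path b (base X)), Lifts δ (Path.refl x) T →
    Pi1Qtop.mk _ _ (η.trans δ) ∈ (circleHom X).range

theorem ClosesUp.of_homotopic {b : GeneralizedWedge X} {η η' : Path (base X) b} (h : ClosesUp η)
    (hη : η.Homotopic η') : ClosesUp η' := by
  intro x t t' T δ hδ
  rw [← Pi1Qtop.mk_eq_of_homotopic (hη.hcomp (Path.Homotopic.refl δ))]
  exact h x t t' T δ hδ

theorem closesUp_of_forall_eq {b : GeneralizedWedge X} {η : Path (base X) b}
    (h : ∀ s, η s = base X) : ClosesUp η := by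
  obtain rfl : b = base X := η.target ▸ h 1
  obtain rfl : η = Path.refl _ := by
    ext s
    exact h s
  intro x t t' T δ hδ
  exact mul_mem hδ.mem_range (one_mem _)

theorem ClosesUp.mk_mem [Nonempty X] {b : GeneralizedWedge X} {η : Path (base X) b}
    (h : ClosesUp η) (hb : b = base X) :
    Pi1Qtop.mk _ _ (η.cast rfl hb.symm) ∈ (circleHom X).range := by
  subst hb
  have := h (Classical.arbitrary X) 0 0 (Path.refl 0) (Path.refl _) fun s => (point_zero _).symm
  rwa [Pi1Qtop.mk_eq_of_homotopic ⟨Path.Homotopy.transRefl η⟩] at this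

/-- Insert a detour `ε` from `b` to the basepoint along the fibre and back: `η · ε` is covered by
the hypothesis on `η`, and `ε⁻¹ · κ · δ` is treated through its lift. -/
theorem ClosesUp.trans {b b' : GeneralizedWedge X} {η : Path (base X) b} (h : ClosesUp η)
    {κ : Path b b'} {x x' : X} {t t' : I} {A : Path x x'} {S : Path t t'} (hκ : Lifts κ A S) :
    ClosesUp (η.trans κ) := by
  intro y r r' T δ hδ
  have hb : point (x, t) = b := by simpa using (hκ 0).symm
  have hb' : point (x', t') = b' := by simpa using (hκ 1).symm
  have hd : point (y, r) = b' := by simpa using (hδ 0).symm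
  obtain ⟨T₀⟩ : Joined t 0 := PathConnectedSpace.joined _ _
  let ε : Path b (base X) := (((Path.refl x).prod T₀).map continuous_point).cast hb.symm
    (point_zero x).symm
  have hε : Lifts ε (Path.refl x) T₀ := fun s => rfl
  have hmem : Pi1Qtop.mk _ _ (ε.symm.trans (κ.trans δ)) ∈ (circleHom X).range := by
    -- At the basepoint the lifts of `κ` and `δ` need not match, but there `ε⁻¹ · κ` and `δ` are
    -- separately loops. Elsewhere `point` is injective, so the lifts concatenate.
    by_cases hbase : b' = base X
    · subst hbase
      rw [← Pi1Qtop.mk_eq_of_homotopic ⟨Path.Homotopy.transAssoc ε.symm κ δ⟩, Pi1Qtop.mk_trans]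
      exact mul_mem hδ.mem_range (hε.symm.trans hκ).mem_range
    · have hmem : ∀ p : X × I, point p = b' → coord b' = some p := by
        rintro p rfl
        refine coord_point ?_ ?_
        · intro h0
          exact hbase (point_eq_base_of (x := p.1) (Or.inl h0))
        · intro h1
          exact hbase (point_eq_base_of (x := p.1) (Or.inr h1))
      have heq := (hmem _ hb').symm.trans (hmem _ hd)
      simp only [Option.some.injEq, Prod.mk.injEq] at heq
      obtain ⟨rfl, rfl⟩ := heq
      exact (hε.symm.trans (hκ.trans hδ)).mem_range
  have hhom : ((η.trans ε).trans (ε.symm.trans (κ.trans δ))).Homotopic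
      ((η.trans κ).trans δ) := by
    rw [← Path.Homotopic.Quotient.eq]
    simp only [Path.Homotopic.Quotient.mk_trans, Path.Homotopic.Quotient.mk_symm]
    rw [Path.Homotopic.Quotient.trans_assoc,
      ← Path.Homotopic.Quotient.trans_assoc (Path.Homotopic.Quotient.mk ε),
      Path.Homotopic.Quotient.trans_symm, Path.Homotopic.Quotient.refl_trans,
      Path.Homotopic.Quotient.trans_assoc]
  rw [← Pi1Qtop.mk_eq_of_homotopic hhom, Pi1Qtop.mk_trans]
  exact mul_mem hmem (h x t 0 T₀ ε hε)

/-- Stretching the middle third of `I` over `I`. -/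
noncomputable def stretch (t : I) : I := projIcc 0 1 zero_le_one (3 * (t : ℝ) - 1)

theorem continuous_stretch : Continuous stretch :=
  continuous_projIcc.comp (by fun_prop)

theorem stretch_eq_zero {t : I} (h : (t : ℝ) ≤ 1 / 3) : stretch t = 0 :=
  projIcc_of_le_left _ (by linarith)

theorem stretch_eq_one {t : I} (h : 2 / 3 ≤ (t : ℝ)) : stretch t = 1 :=
  projIcc_of_right_le _ (by linarith)

/-- The homotopy from the identity of `Σ(X₊)` to the map stretching the middle third. -/
noncomputable def stretchHomotopy (q : GeneralizedWedge X × I) : GeneralizedWedge X :=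
  (coord q.1).elim (base X) fun p => point (p.1, Icc.convexComb p.2 (stretch p.2) q.2)

theorem stretchHomotopy_point (p : X × I) (s : I) :
    stretchHomotopy (point p, s) = point (p.1, Icc.convexComb p.2 (stretch p.2) s) := by
  obtain ⟨x, t⟩ := p
  by_cases h0 : t = 0
  · subst h0
    rw [point_zero, stretch_eq_zero (by norm_num), Icc.convexComb_eq, point_zero]
    rfl
  · by_cases h1 : t = 1
    · subst h1
      rw [point_one, stretch_eq_one (by norm_num), Icc.convexComb_eq, point_one]
      rfl
    · simp [stretchHomotopy, coord_point (p := (x, t)) h0 h1]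

theorem stretchHomotopy_base (s : I) : stretchHomotopy (base X, s) = base X := rfl

theorem stretchHomotopy_zero (b : GeneralizedWedge X) : stretchHomotopy (b, 0) = b := by
  rcases eq_base_or_exists b with rfl | ⟨p, rfl⟩
  · rfl
  · rw [stretchHomotopy_point, Icc.convexComb_zero]

/-- The product of the quotient map `point` with the locally compact space `I` is again a quotient
map. -/
theorem continuous_stretchHomotopy [Nonempty X] :
    Continuous (stretchHomotopy (X := X)) := by
  refine isQuotientMap_point.continuous_lift_prod_left ?_
  simp only [stretchHomotopy_point]
  refine continuous_point.comp (Continuous.prodMk (by fun_prop) ?_)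
  have := continuous_stretch
  exact Icc.continuous_convexComb_prod.comp
    (by fun_prop : Continuous fun p : (X × I) × I => (p.1.2, stretch p.1.2, p.2))

variable (X) in
/-- The complement of the closed middle third `X × [1/3, 2/3]`. -/
def offThird : Set (GeneralizedWedge X) :=
  {b | ∀ p, coord b = some p → (p.2 : ℝ) < 1 / 3 ∨ 2 / 3 < (p.2 : ℝ)}

theorem isOpen_offThird : IsOpen (offThird X) := by
  rw [isOpen_iff]
  have : point ⁻¹' offThird X =
      {p : X × I | (p.2 : ℝ) < 1 / 3} ∪ {p : X × I | 2 / 3 < (p.2 : ℝ)} := by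
    ext p
    by_cases h : p.2 ≠ 0 ∧ p.2 ≠ 1
    · simp only [offThird, mem_preimage, mem_ofPred_eq, coord_point h.1 h.2, Option.some.injEq,
        forall_eq', mem_union]
    · have hn : coord (point p) = none := by
        rw [not_and_or, not_ne_iff, not_ne_iff] at h
        rw [point_eq_base_of (x := p.1) h, coord_base]
      rw [not_and_or, not_ne_iff, not_ne_iff] at h
      refine iff_of_true (fun q hq => absurd (hn.symm.trans hq) (by simp)) ?_
      rcases h with h | h
      · exact Or.inl (by simp [h])
      · refine Or.inr ?_
        change 2 / 3 < (p.2 : ℝ)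
        rw [h]
        norm_num
  rw [this]
  exact (isOpen_lt (by fun_prop) continuous_const).union (isOpen_lt continuous_const (by fun_prop))

theorem stretchHomotopy_one_of_mem {b : GeneralizedWedge X} (hb : b ∈ offThird X) :
    stretchHomotopy (b, 1) = base X := by
  rcases h : coord b with _ | p
  · simp [stretchHomotopy, h]
  · simp only [stretchHomotopy, h, Option.elim_some, Icc.convexComb_one]
    rcases hb p h with hp | hp
    · rw [stretch_eq_zero hp.le, point_zero]
    · rw [stretch_eq_one hp.le, point_one]

theorem stretchHomotopy_one_eq (x₀ : X) {b : GeneralizedWedge X} (hb : b ∈ punctured X) :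
    stretchHomotopy (b, 1) = point (proj x₀ b, stretch (height b)) := by
  obtain ⟨p, hp⟩ := hb
  simp [stretchHomotopy, proj, height, hp, Icc.convexComb_one]

/-- Near the basepoint a loop need not lift to `X × I`. Stretching the middle third is homotopic to
the identity and collapses a neighbourhood of the basepoint, so each piece of the stretched loop `ρ`
either is constant or lifts. -/
theorem mk_mem_range [Nonempty X] (γ : Path (base X) (base X)) :
    Pi1Qtop.mk _ _ γ ∈ (circleHom X).range := by
  let x₀ := Classical.arbitrary X
  let ρ : Path (base X) (base X) :=
    { toFun := fun s => stretchHomotopy (γ s, 1)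
      continuous_toFun := continuous_stretchHomotopy.comp (by fun_prop)
      source' := by rw [γ.source, stretchHomotopy_base]
      target' := by rw [γ.target, stretchHomotopy_base] }
  have hγρ : γ.Homotopic ρ :=
    ⟨{ toFun := fun q => stretchHomotopy (γ q.2, q.1)
       continuous_toFun := continuous_stretchHomotopy.comp (by fun_prop)
       map_zero_left := fun s => stretchHomotopy_zero _
       map_one_left := fun s => rfl
       prop' := by
        rintro t s (rfl | rfl)
        · simp [stretchHomotopy_base]
        · simp [stretchHomotopy_base] }⟩
  obtain ⟨t, j, N, h0, hm, hN, hj⟩ := γ.exists_subdivision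
    (W := fun i : Bool => if i then punctured X else offThird X)
    (by rintro (_ | _); exacts [isOpen_offThird, isOpen_punctured])
    (fun b => by
      by_cases hb : b ∈ punctured X
      · exact ⟨true, hb⟩
      · exact ⟨false, fun p hp => absurd ⟨p, hp⟩ hb⟩)
  have key : ∀ n, ClosesUp ((ρ.subpath 0 (t n)).cast ρ.source.symm rfl) := by
    intro n
    induction n with
    | zero =>
      refine closesUp_of_forall_eq fun s => ?_
      rw [h0, Path.subpath_self]
      simp
    | succ n ih =>
      have hhom : (((ρ.subpath 0 (t n)).cast ρ.source.symm rfl).trans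
          (ρ.subpath (t n) (t (n + 1)))).Homotopic
          ((ρ.subpath 0 (t (n + 1))).cast ρ.source.symm rfl) :=
        Path.Homotopic.pathCast ⟨Path.Homotopy.subpathTransSubpath ρ 0 (t n) (t (n + 1))⟩
          ρ.source.symm rfl
      refine ClosesUp.of_homotopic ?_ hhom
      have hsub : ∀ s, Icc.convexComb (t n) (t (n + 1)) s ∈ Icc (t n) (t (n + 1)) := fun s =>
        ⟨Icc.le_convexComb (hm n.le_succ) s, Icc.convexComb_le (hm n.le_succ) s⟩
      have hc := Icc.continuous_convexComb (t n) (t (n + 1))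
      rcases hjn : j n with _ | _
      · have hmem : ∀ s ∈ Icc (t n) (t (n + 1)), γ s ∈ offThird X := by
          have := hj n
          rwa [hjn] at this
        -- On this piece `ρ` rests at the basepoint, so the constant lift at `(x₀, 0)` serves.
        refine ih.trans (A := Path.refl x₀) (S := Path.refl 0) fun s => ?_
        exact (stretchHomotopy_one_of_mem (hmem _ (hsub s))).trans (point_zero _).symm
      · have hmem : ∀ s ∈ Icc (t n) (t (n + 1)), γ s ∈ punctured X := by
          have := hj n
          rwa [hjn] at this
        have hA : Continuous fun s => proj x₀ (γ (Icc.convexComb (t n) (t (n + 1)) s)) :=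
          (continuousOn_proj x₀).comp_continuous (by fun_prop) fun s => hmem _ (hsub s)
        have hS : Continuous fun s => stretch (height (γ (Icc.convexComb (t n) (t (n + 1)) s))) :=
          continuous_stretch.comp
            (continuousOn_height.comp_continuous (by fun_prop) fun s => hmem _ (hsub s))
        refine ih.trans (A := ⟨⟨_, hA⟩, rfl, rfl⟩) (S := ⟨⟨_, hS⟩, rfl, rfl⟩) fun s => ?_
        exact stretchHomotopy_one_eq x₀ (hmem _ (hsub s))
  have hlast := key N
  rw [hN] at hlast
  have hmem := hlast.mk_mem ρ.target
  have he : ((ρ.subpath 0 1).cast ρ.source.symm rfl).cast rfl ρ.target.symm = ρ := by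
    ext s
    simp
  rw [he] at hmem
  rwa [Pi1Qtop.mk_eq_of_homotopic hγρ]

theorem circleHom_surjective : Function.Surjective (circleHom X) := by
  intro p
  induction p using Path.Homotopic.Quotient.ind with | mk γ
  rcases isEmpty_or_nonempty X with hX | hX
  · refine ⟨1, ?_⟩
    have : γ = Path.refl _ := by
      ext s
      rcases eq_base_or_exists (γ s) with h | ⟨p, -⟩
      · exact h
      · exact hX.elim p.1
    rw [this, map_one]
    rfl
  · exact mk_mem_range γ

theorem holonomy_injective : Function.Injective (holonomy X) := by
  intro p q h
  obtain ⟨v, rfl⟩ := circleHom_surjective p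
  obtain ⟨w, rfl⟩ := circleHom_surjective q
  rw [holonomy_circleHom, holonomy_circleHom] at h
  rw [h]

end GeneralizedWedge

/-! ### The free topological group on a functionally Hausdorff space is Hausdorff. -/

open Set Topology Filter MeasureTheory

/-- A left inverse of `f` on the letters of `w` recovers `w` from its image. -/
theorem FreeGroup.map_ne_one_of_injOn {α β : Type*} [DecidableEq α] {w : FreeGroup α}
    (hw : w ≠ 1) {f : α → β} (hf : InjOn f {a | ∃ b, (a, b) ∈ w.toWord}) : FreeGroup.map f w ≠ 1 := by
  intro h
  obtain ⟨a₀⟩ : Nonempty α := by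
    by_contra hα
    rw [not_nonempty_iff] at hα
    exact hw (Subsingleton.elim _ _)
  have : Nonempty α := ⟨a₀⟩
  obtain ⟨g, hl⟩ : ∃ g, LeftInvOn g f {a | ∃ b, (a, b) ∈ w.toWord} := ⟨_, hf.leftInvOn_invFunOn⟩
  have hid : FreeGroup.map (g ∘ f) w = w := by
    conv_rhs => rw [← FreeGroup.mk_toWord (x := w)]
    conv_lhs => rw [← FreeGroup.mk_toWord (x := w)]
    rw [FreeGroup.map.mk]
    congr 1
    refine (List.map_congr_left fun p hp => ?_).trans (List.map_id _)
    exact Prod.ext (hl ⟨p.2, hp⟩) rfl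
  apply hw
  rw [← hid, ← FreeGroup.map.comp, h, _root_.map_one]

section

variable {Z : Type u} {ι : Type*} (f : ι → Z → ℝ)

/-- The vector of truth values of `θ < f i z`. -/
def thresholds (θ : ℝ) (z : Z) : ι → Prop := fun i => θ < f i z

/-- The distance on the free group measuring the set of thresholds `θ ∈ (0, 1)` at which two words
have different images. -/
noncomputable def thresholdDist (v w : FreeGroup Z) : ENNReal :=
  volume {θ : ℝ | θ ∈ Ioo (0 : ℝ) 1 ∧
    FreeGroup.map (thresholds f θ) v ≠ FreeGroup.map (thresholds f θ) w}

/-- A type synonym of the free group, with the topology of `thresholdDist`. -/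
def ThresholdGroup (_ : ι → Z → ℝ) : Type u := FreeGroup Z

instance : Group (ThresholdGroup f) := inferInstanceAs (Group (FreeGroup Z))

noncomputable instance : PseudoEMetricSpace (ThresholdGroup f) where
  edist v w := thresholdDist f v w
  edist_self v := by simp [thresholdDist]
  edist_comm v w := by simp only [thresholdDist, ne_comm]
  edist_triangle u v w := by
    refine (measure_mono ?_).trans (measure_union_le _ _)
    rintro θ ⟨hθ, h⟩
    by_cases h' : FreeGroup.map (thresholds f θ) u = FreeGroup.map (thresholds f θ) v
    · exact Or.inr ⟨hθ, h' ▸ h⟩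
    · exact Or.inl ⟨hθ, h'⟩

/-- Each threshold induces a homomorphism of free groups, so products agree wherever both factors
do. Only monotonicity and subadditivity of volume are needed, so measurability plays no role. -/
theorem ThresholdGroup.edist_mul_le (a b c d : ThresholdGroup f) :
    edist (a * b) (c * d) ≤ edist a c + edist b d := by
  refine (measure_mono (μ := volume) ?_).trans (measure_union_le _ _)
  rintro θ ⟨hθ, h⟩
  by_cases h' : FreeGroup.map (thresholds f θ) a = FreeGroup.map (thresholds f θ) c
  · refine Or.inr ⟨hθ, fun h'' => h ?_⟩
    have e (v w : FreeGroup Z) : FreeGroup.map (thresholds f θ) (v * w) = _ := map_mul _ v w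
    exact (e a b).trans (h' ▸ h'' ▸ (e c d).symm)
  · exact Or.inl ⟨hθ, h'⟩

theorem ThresholdGroup.edist_inv_le (a b : ThresholdGroup f) : edist a⁻¹ b⁻¹ ≤ edist a b := by
  refine measure_mono (μ := volume) ?_
  rintro θ ⟨hθ, h⟩
  refine ⟨hθ, fun h' => h ?_⟩
  have e (v : FreeGroup Z) : FreeGroup.map (thresholds f θ) v⁻¹ = _ := map_inv _ v
  exact (e a).trans (h' ▸ (e b).symm)

instance : IsTopologicalGroup (ThresholdGroup f) where
  continuous_mul := by
    rw [continuous_iff_continuousAt]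
    rintro ⟨a, b⟩
    rw [ContinuousAt, tendsto_iff_edist_tendsto_0]
    have h : Tendsto (fun p : ThresholdGroup f × ThresholdGroup f => edist p.1 a + edist p.2 b)
        (𝓝 (a, b)) (𝓝 0) := by
      have : Continuous fun p : ThresholdGroup f × ThresholdGroup f =>
          edist p.1 a + edist p.2 b := by fun_prop
      simpa using this.tendsto (a, b)
    exact tendsto_of_tendsto_of_tendsto_of_le_of_le tendsto_const_nhds h (fun _ => zero_le)
      fun p => ThresholdGroup.edist_mul_le f _ _ _ _
  continuous_inv := by
    have : LipschitzWith 1 (fun a : ThresholdGroup f => a⁻¹) :=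
      LipschitzWith.of_edist_le (ThresholdGroup.edist_inv_le f)
    exact this.continuous

/-- The canonical map to the group. -/
def ThresholdGroup.of (z : Z) : ThresholdGroup f := FreeGroup.of z

/-- A threshold separates `y` from `z` only if it lies between `f i y` and `f i z` for some `i`; the
lengths of these finitely many intervals tend to 0. -/
theorem ThresholdGroup.continuous_of [TopologicalSpace Z] [Finite ι]
    (hf : ∀ i, Continuous (f i)) : Continuous (ThresholdGroup.of f) := by
  have := Fintype.ofFinite ι
  rw [continuous_iff_continuousAt]
  intro z
  rw [ContinuousAt, tendsto_iff_edist_tendsto_0]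
  have h : Tendsto (fun y => ∑ i, ENNReal.ofReal |f i z - f i y|) (𝓝 z) (𝓝 0) := by
    have : Continuous fun y => ∑ i, ENNReal.ofReal |f i z - f i y| :=
      continuous_finsetSum _ fun i _ => ENNReal.continuous_ofReal.comp
        ((continuous_const.sub (hf i)).abs)
    simpa using this.tendsto z
  refine tendsto_of_tendsto_of_tendsto_of_le_of_le tendsto_const_nhds h (fun _ => zero_le)
    fun y => ?_
  calc edist (of f y) (of f z)
    _ ≤ volume (⋃ i, uIcc (f i y) (f i z)) := by
      refine measure_mono ?_
      rintro θ ⟨-, hθ⟩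
      by_contra hn
      refine hθ (congrArg FreeGroup.of (funext fun i => propext ?_))
      simp only [mem_iUnion, not_exists] at hn
      have hi := hn i
      rw [mem_uIcc] at hi
      push Not at hi
      constructor
      · intro hy
        by_contra hz
        exact absurd (hi.2 (not_lt.1 hz)) (not_lt.2 hy.le)
      · intro hz
        by_contra hy
        exact absurd (hi.1 (not_lt.1 hy)) (not_lt.2 hz.le)
    _ ≤ ∑ i, volume (uIcc (f i y) (f i z)) := measure_iUnion_fintype_le _ _
    _ = ∑ i, ENNReal.ofReal |f i z - f i y| := by simp [Real.volume_interval]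

end

theorem FunctionallyHausdorff.exists_zero_one {Z : Type u} [TopologicalSpace Z]
    (h : FunctionallyHausdorff Z) {x y : Z} (hxy : x ≠ y) :
    ∃ f : C(Z, ℝ), f x = 0 ∧ f y = 1 := by
  obtain ⟨f, hf⟩ := h x y hxy
  refine ⟨⟨fun z => (f z - f x) / (f y - f x), by fun_prop⟩, by simp, ?_⟩
  simpa using div_self (sub_ne_zero.2 hf.symm)

/-- Given `w ≠ 1`, take for each ordered pair of distinct letters of `w` a function that is 0 at the
first and 1 at the second. Every threshold in (0, 1) then keeps all letters of `w` apart, so `w` has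
distance at least 1 from the identity. -/
theorem FreeTopGroup.t2Space {Z : Type u} [TopologicalSpace Z] (hZ : FunctionallyHausdorff Z) :
    T2Space (FreeTopGroup Z) := by
  suffices h : ∀ w : FreeTopGroup Z, w ≠ 1 → ∃ O : Set (FreeTopGroup Z), IsOpen O ∧ 1 ∈ O ∧ w ∉ O by
    have hT1 : IsClosed ({1} : Set (FreeTopGroup Z)) := by
      rw [← isOpen_compl_iff, isOpen_iff_mem_nhds]
      intro w hw
      obtain ⟨O, hO, h1, hwO⟩ := h w⁻¹ (inv_ne_one.2 hw)
      have hc : Continuous fun v : FreeTopGroup Z => w⁻¹ * v := by fun_prop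
      refine mem_of_superset ((hO.preimage hc).mem_nhds (by simpa using h1)) fun v hv hv1 => ?_
      rw [mem_singleton_iff] at hv1
      subst hv1
      exact hwO (by simpa using hv)
    have : T1Space (FreeTopGroup Z) := IsTopologicalGroup.t1Space _ hT1
    infer_instance
  intro w hw
  classical
  let S : Set Z := {a | ∃ b, (a, b) ∈ FreeGroup.toWord (w : FreeGroup Z)}
  have hS : S.Finite := by
    refine ((FreeGroup.toWord (w : FreeGroup Z)).map Prod.fst).toFinset.finite_toSet.subset ?_
    rintro a ⟨b, hb⟩
    exact List.mem_toFinset.2 (List.mem_map.2 ⟨(a, b), hb, rfl⟩)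
  let ι := {p : S × S // p.1 ≠ p.2}
  have : Finite S := hS
  choose f hf0 hf1 using fun i : ι =>
    hZ.exists_zero_one (fun h => i.2 (Subtype.ext h) : (i.1.1 : Z) ≠ i.1.2)
  let φ := FreeTopGroup.lift (ThresholdGroup.of fun i => f i)
  have hφ : Continuous φ := FreeTopGroup.continuous_lift _
    (ThresholdGroup.continuous_of _ fun i => (f i).continuous)
  have hφw : (φ w : FreeGroup Z) = w := DFunLike.congr_fun (FreeGroup.lift_of_eq_id Z) w
  -- The radius 1 is the length of the interval of thresholds.
  refine ⟨φ ⁻¹' Metric.eball 1 1, Metric.isOpen_eball.preimage hφ, by simp, fun hmem => ?_⟩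
  have hlt : thresholdDist (fun i => f i) w 1 < 1 :=
    (congrArg (fun v : FreeGroup Z => thresholdDist (fun i => f i) v 1) hφw).symm.trans_lt
      (Metric.mem_eball.1 hmem)
  refine absurd hlt (not_lt.2 ?_)
  have hsub : Ioo (0 : ℝ) 1 ⊆ {θ : ℝ | θ ∈ Ioo (0 : ℝ) 1 ∧
      FreeGroup.map (thresholds (fun i => f i) θ) w ≠
        FreeGroup.map (thresholds (fun i => f i) θ) 1} := by
    intro θ hθ
    refine ⟨hθ, ?_⟩
    rw [map_one]
    refine FreeGroup.map_ne_one_of_injOn hw fun a ha b hb hab => ?_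
    by_contra hne
    have hi := congrFun hab ⟨(⟨a, ha⟩, ⟨b, hb⟩), fun h => hne (congrArg Subtype.val h)⟩
    simp only [thresholds, hf0, hf1, eq_iff_iff] at hi
    exact absurd (hi.2 hθ.2) (not_lt.2 hθ.1.le)
  calc (1 : ENNReal) = volume (Ioo (0 : ℝ) 1) := by simp
    _ ≤ _ := measure_mono hsub

/-! ### Comparison of the topologies, and the equivalence. -/

theorem FunctionallyHausdorff.of_injective {Y : Type u} {Z : Type v} [TopologicalSpace Y]
    [TopologicalSpace Z] (hZ : FunctionallyHausdorff Z) {f : Y → Z} (hf : Continuous f)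
    (hi : Function.Injective f) : FunctionallyHausdorff Y := fun x y hxy => by
  obtain ⟨g, hg⟩ := hZ (f x) (f y) (hi.ne hxy)
  exact ⟨g.comp ⟨f, hf⟩, hg⟩

theorem functionallyHausdorff_of_t1 {Y : Type u} [TopologicalSpace Y] [T1Space Y]
    [CompletelyRegularSpace Y] : FunctionallyHausdorff Y := fun x y hxy => by
  obtain ⟨f, hf, hx, hy⟩ := CompletelyRegularSpace.completely_regular x {y} isClosed_singleton hxy
  refine ⟨⟨fun z => (f z : ℝ), by fun_prop⟩, ?_⟩
  simp [hx, hy (mem_singleton y)]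

/-- The topology comes from a uniformity, hence is completely regular. -/
theorem IsTopologicalGroup.functionallyHausdorff {G : Type u} [Group G] [TopologicalSpace G]
    [IsTopologicalGroup G] [T2Space G] : FunctionallyHausdorff G := by
  let _ : UniformSpace G := IsTopologicalGroup.rightUniformSpace G
  exact functionallyHausdorff_of_t1

/-- The identity map from `G` to `τ(G)`. -/
def Tau.of {G : Type u} (g : G) : Tau G := g

theorem Tau.continuous_of {G : Type u} [Group G] [TopologicalSpace G] :
    Continuous (Tau.of : G → Tau G) := by
  have h : (Tau.of : G → Tau G) = Tau.mulHom G ∘ FreeTopGroup.of :=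
    funext fun g => FreeGroup.lift_apply_of.symm
  rw [h]
  exact continuous_coinduced_rng.comp (FreeTopGroup.continuous_of G)

/-- Pulled back to `F_M(G)`, the homomorphism is the extension of a continuous map on `G`, and the
topology of `τ(G)` is the quotient one. -/
theorem Tau.continuous_of_monoidHom {G : Type u} [Group G] [TopologicalSpace G] {H : Type v}
    [Group H] [TopologicalSpace H] [IsTopologicalGroup H] (φ : G →* H) (hφ : Continuous φ) :
    Continuous fun g : Tau G => φ (g : G) := by
  refine continuous_coinduced_dom.2 ?_
  have h : (fun g : Tau G => φ (g : G)) ∘ Tau.mulHom G = FreeTopGroup.lift φ := by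
    have : (φ : Tau G →* H).comp (Tau.mulHom G) = FreeTopGroup.lift φ := by
      refine FreeGroup.ext_hom _ _ fun g => ?_
      refine Eq.trans ?_ FreeGroup.lift_apply_of.symm
      exact congrArg φ FreeGroup.lift_apply_of
    exact congrArg DFunLike.coe this
  rw [h]
  exact FreeTopGroup.continuous_lift _ hφ

theorem mainTheorem7 (X : Type u) [TopologicalSpace X] :
    List.TFAE
      [T2Space (Pi1Tau (GeneralizedWedge X) (GeneralizedWedge.base X)),
       FunctionallyHausdorff (Pi1Qtop (GeneralizedWedge X) (GeneralizedWedge.base X)),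
       FunctionallyHausdorff (ZerothHomotopy X)] := by
  tfae_have 1 → 2 := fun _ =>
    (IsTopologicalGroup.functionallyHausdorff
      (G := Pi1Tau (GeneralizedWedge X) (GeneralizedWedge.base X))).of_injective
      Tau.continuous_of fun _ _ h => h
  tfae_have 2 → 3 := fun h => h.of_injective GeneralizedWedge.continuous_circleClass
    fun y z hyz => by
      have := congrArg (GeneralizedWedge.holonomy X) hyz
      rw [GeneralizedWedge.holonomy_circleClass, GeneralizedWedge.holonomy_circleClass] at this
      exact FreeGroup.of_injective this
  tfae_have 3 → 1 := fun h => by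
    have := FreeTopGroup.t2Space h
    exact T2Space.of_injective_continuous GeneralizedWedge.holonomy_injective
      (Tau.continuous_of_monoidHom (GeneralizedWedge.holonomy X) GeneralizedWedge.continuous_holonomy)
  tfae_finish
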